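/- Let $\Gamma(\mathbb C^n)$ be the boson Fock space over $\mathbb C^n$ with exponential vectors $|e(\mathbf u)\rangle=\bigoplus_{k\ge 0}\mathbf u^{\otimes k}/\sqrt{k!}$, coherent states $|\mathbf v\rangle=e^{-|\mathbf v|^2/2}|e(\mathbf v)\rangle$ and Weyl operators $W(\mathbf u)$, the bounded operators determined by $W(\mathbf u)|\mathbf v\rangle=e^{-i\,\mathrm{Im}(\mathbf u^\dagger\mathbf v)}|\mathbf u+\mathbf v\rangle$ for all $\mathbf v\in\mathbb C^n$. A state (positive operator of trace one) $\rho$ on $\Gamma(\mathbb C^n)$ is a Gaussian state with mean $\mathbf m\in\mathbb C^n$ and covariance operator $S$ (a real linear operator on $\mathbb C^n$, symmetric for the inner product $\mathrm{Re}(\mathbf u^\dagger\mathbf v)$) if $$\operatorname{tr}\rho W(\mathbf z)=\exp\{-2i\,\mathrm{Im}(\mathbf z^\dagger\mathbf m)-\mathrm{Re}(\mathbf z^\dagger S\mathbf z)\}\qquad\text{for all }\mathbf z\in\mathbb C^n.$$ Its covariance matrix $S_{\mathbb R}$ is the real $2n\times 2n$ matrix of $S$ under the identification $\mathbb C^n\ni\mathbf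 x+i\mathbf y\leftrightarrow(\mathbf x,\mathbf y)\in\mathbb R^{2n}$. A Gaussian state $\rho$ is called classical if $$\rho=\int_{\mathbb C^n}|\boldsymbol\alpha\rangle\langle\boldsymbol\alpha|\,\mathcal N_{\boldsymbol\mu,\Sigma}(d\boldsymbol\alpha)$$ as a weak operator integral, for some (possibly degenerate) normal distribution $\mathcal N_{\boldsymbol\mu,\Sigma}$ on $\mathbb C^n\cong\mathbb R^{2n}$ with mean $\boldsymbol\mu\in\mathbb R^{2n}$ and positive semidefinite covariance matrix $\Sigma\in M_{2n}(\mathbb R)$. Let $J=\begin{pmatrix}0&I_n\\-I_n&0\end{pmatrix}$. Theorem. (1) For every $\boldsymbol\mu\in\mathbb R^{2n}$ and every positive semidefinite $\Sigma\in M_{2n}(\mathbb R)$, the weak operator integral $\rho=\int|\boldsymbol\alpha\rangle\langle\boldsymbol\alpha|\,\mathcal N_{\boldsymbol\mu,\Sigma}(d\boldsymbol\alpha)$ exists as a bounded operator and is a Gaussian state, and its covariance matrix is $$S_{\mathbb R}=\tfrac12 I_{2n}+2J^T\Sigma J.$$ (2) Consequently, an $n$-mode Gaussian state with covariance matrix $S_{\mathbb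 R}$ is classical if and only if $S_{\mathbb R}\ge\tfrac12 I_{2n}$, that is, $S_{\mathbb R}-\tfrac12 I_{2n}$ is positive semidefinite. -/

import Mathlib

open scoped InnerProductSpace Nat Topology

noncomputable section

namespace QuantumGaussian

/-! ### The boson Fock space over `ℂⁿ` -/

/-- The space `ℂⁿ` with its Euclidean inner product `⟪u, v⟫ = u† v` (antilinear in `u`). -/
abbrev Modes (n : ℕ) : Type := EuclideanSpace ℂ (Fin n)

/-- Tensors in `(ℂⁿ)^{⊗k}`, written through their coordinates in the product basis
`e_{f 0} ⊗ ⋯ ⊗ e_{f (k-1)}`, that are invariant under all permutations of the `k` factors. -/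
def symSubmodule (n k : ℕ) : Submodule ℂ (EuclideanSpace ℂ (Fin k → Fin n)) where
  carrier := {x | ∀ (σ : Equiv.Perm (Fin k)) (f : Fin k → Fin n), x (f ∘ σ) = x f}
  add_mem' := by
    intro x y hx hy σ f
    simp [hx σ f, hy σ f]
  zero_mem' := by
    intro σ f
    simp
  smul_mem' := by
    intro c x hx σ f
    simp [hx σ f]

/-- The `k`-th symmetric tensor power of `ℂⁿ`, with the inner product of `(ℂⁿ)^{⊗k}`. -/
def SymTensor (n k : ℕ) : Type := symSubmodule n k

instance (n k : ℕ) : NormedAddCommGroup (SymTensor n k) :=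
  inferInstanceAs (NormedAddCommGroup (symSubmodule n k))

instance (n k : ℕ) : InnerProductSpace ℂ (SymTensor n k) :=
  inferInstanceAs (InnerProductSpace ℂ (symSubmodule n k))

instance (n k : ℕ) : CompleteSpace (SymTensor n k) :=
  inferInstanceAs (CompleteSpace (symSubmodule n k))

/-- The coordinates of a symmetric tensor. -/
def SymTensor.coord {n k : ℕ} (x : SymTensor n k) (f : Fin k → Fin n) : ℂ :=
  (show symSubmodule n k from x).1 f

theorem SymTensor.coord_perm {n k : ℕ} (x : SymTensor n k) (σ : Equiv.Perm (Fin k))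
    (f : Fin k → Fin n) : x.coord (f ∘ σ) = x.coord f :=
  (show symSubmodule n k from x).2 σ f

theorem SymTensor.ext {n k : ℕ} {x y : SymTensor n k} (h : ∀ f, x.coord f = y.coord f) : x = y := by
  apply Subtype.ext
  ext f
  exact h f

theorem SymTensor.inner_eq {n k : ℕ} (x y : SymTensor n k) :
    ⟪x, y⟫_ℂ = ∑ f, (starRingEnd ℂ) (x.coord f) * y.coord f := by
  have h : ⟪x, y⟫_ℂ = ⟪(show symSubmodule n k from x).1, (show symSubmodule n k from y).1⟫_ℂ := rfl
  rw [h, PiLp.inner_apply]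
  exact Finset.sum_congr rfl fun f _ => mul_comm _ _

/-- The boson Fock space `Γ(ℂⁿ)`: the Hilbert space direct sum of the symmetric tensor powers. -/
abbrev Fock (n : ℕ) : Type := lp (SymTensor n) 2

/-- The product tensor `u^{⊗k}`. -/
def tensorPow {n : ℕ} (u : Modes n) (k : ℕ) : SymTensor n k :=
  show symSubmodule n k from
  ⟨WithLp.toLp 2 (fun f : Fin k → Fin n => ∏ i, u (f i)), by
    intro σ f
    exact Equiv.prod_comp σ (fun i => u (f i))⟩

theorem coord_tensorPow {n : ℕ} (u : Modes n) (k : ℕ) (f : Fin k → Fin n) :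
    (tensorPow u k).coord f = ∏ i, u (f i) := rfl

theorem coord_smul {n k : ℕ} (t : ℂ) (x : SymTensor n k) (f : Fin k → Fin n) :
    (t • x).coord f = t * x.coord f := rfl

theorem inner_tensorPow {n : ℕ} (u v : Modes n) (k : ℕ) :
    ⟪tensorPow u k, tensorPow v k⟫_ℂ = ⟪u, v⟫_ℂ ^ k := by
  rw [SymTensor.inner_eq, PiLp.inner_apply, Fintype.sum_pow]
  refine Finset.sum_congr rfl fun f _ => ?_
  simp only [coord_tensorPow, map_prod, ← Finset.prod_mul_distrib, RCLike.inner_apply]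
  exact Finset.prod_congr rfl fun i _ => mul_comm _ _

theorem norm_tensorPow {n : ℕ} (u : Modes n) (k : ℕ) : ‖tensorPow u k‖ = ‖u‖ ^ k := by
  have h := inner_tensorPow u u k
  rw [inner_self_eq_norm_sq_to_K, inner_self_eq_norm_sq_to_K] at h
  have h2 : ‖tensorPow u k‖ ^ 2 = (‖u‖ ^ k) ^ 2 := by
    rw [← pow_mul, mul_comm k 2, pow_mul]
    exact_mod_cast h
  exact (pow_left_inj₀ (norm_nonneg _) (by positivity) two_ne_zero).1 h2

/-- The exponential vector `e(u) = 1 ⊕ u ⊕ u^{⊗2}/√2! ⊕ ⋯ ⊕ u^{⊗k}/√k! ⊕ ⋯`. -/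
def expVec {n : ℕ} (u : Modes n) : Fock n :=
  ⟨fun k => ((Real.sqrt (k ! : ℝ) : ℝ) : ℂ)⁻¹ • tensorPow u k, by
    refine memℓp_gen ?_
    refine (Real.summable_pow_div_factorial (‖u‖ ^ 2)).congr fun k => ?_
    rw [norm_smul, norm_tensorPow, norm_inv, Complex.norm_real, Real.norm_eq_abs,
      abs_of_nonneg (Real.sqrt_nonneg _)]
    simp only [ENNReal.toReal_ofNat, Real.rpow_ofNat]
    rw [mul_pow, inv_pow, Real.sq_sqrt (by positivity), ← pow_mul, ← pow_mul, mul_comm k 2]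
    field_simp⟩

theorem expVec_apply {n : ℕ} (u : Modes n) (k : ℕ) :
    expVec u k = ((Real.sqrt (k ! : ℝ) : ℝ) : ℂ)⁻¹ • tensorPow u k := rfl

theorem inner_expVec {n : ℕ} (u v : Modes n) :
    ⟪expVec u, expVec v⟫_ℂ = Complex.exp ⟪u, v⟫_ℂ := by
  have h := lp.hasSum_inner (𝕜 := ℂ) (expVec u) (expVec v)
  have h2 := NormedSpace.expSeries_div_hasSum_exp (𝔸 := ℂ) ⟪u, v⟫_ℂ
  rw [← Complex.exp_eq_exp_ℂ] at h2
  refine h.unique (h2.congr_fun ?_)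
  intro k
  rw [expVec_apply, expVec_apply, inner_smul_left, inner_smul_right, inner_tensorPow, map_inv₀,
    Complex.conj_ofReal, ← mul_assoc, ← mul_inv, ← Complex.ofReal_mul,
    Real.mul_self_sqrt (by positivity)]
  push_cast
  field_simp

/-- A symmetric array whose associated homogeneous polynomial vanishes is zero. -/
theorem eq_zero_of_forall_sum_mul_prod {n k : ℕ} (c : (Fin k → Fin n) → ℂ)
    (hc : ∀ (σ : Equiv.Perm (Fin k)) (f : Fin k → Fin n), c (f ∘ σ) = c f)
    (h : ∀ u : Fin n → ℂ, ∑ f, c f * ∏ i, u (f i) = 0) (g : Fin k → Fin n) : c g = 0 := by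
  classical
  let m : (Fin k → Fin n) → (Fin n →₀ ℕ) := fun f => ∑ i, Finsupp.single (f i) 1
  let P : MvPolynomial (Fin n) ℂ := ∑ f, MvPolynomial.monomial (m f) (c f)
  have hP : P = 0 := by
    apply MvPolynomial.funext
    intro u
    rw [map_zero, ← h u, map_sum]
    refine Finset.sum_congr rfl fun f _ => ?_
    have : MvPolynomial.monomial (m f) (c f)
        = MvPolynomial.C (c f) * ∏ i, MvPolynomial.X (f i) := by
      simp only [m, MvPolynomial.X]
      rw [← MvPolynomial.monomial_sum_one, MvPolynomial.C_mul_monomial, mul_one]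
    rw [this]
    simp [map_prod]
  have hmc : ∀ f, m f = m g → c f = c g := by
    intro f hf
    have hcard : ∀ j, Nonempty ({i // f i = j} ≃ {i // g i = j}) := by
      intro j
      rw [← Fintype.card_eq]
      have := DFunLike.congr_fun hf j
      simpa [m, Finsupp.finsetSum_apply, Finsupp.single_apply, Fintype.card_subtype] using this
    let e := fun j => (hcard j).some
    let σ : Equiv.Perm (Fin k) := (Equiv.sigmaFiberEquiv f).symm.trans
      ((Equiv.sigmaCongrRight e).trans (Equiv.sigmaFiberEquiv g))
    have hσ : g ∘ σ = f := by
      funext i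
      exact ((e (f i)) ⟨i, rfl⟩).2
    rw [← hσ, hc]
  have h0 : MvPolynomial.coeff (m g) P = 0 := by rw [hP]; simp
  simp only [P, MvPolynomial.coeff_sum, MvPolynomial.coeff_monomial] at h0
  have h1 : ∀ f, (if m f = m g then c f else 0) = (if m f = m g then 1 else 0) * c g := by
    intro f
    split_ifs with hf
    · rw [hmc f hf, one_mul]
    · simp
  simp only [h1, ← Finset.sum_mul] at h0
  rcases mul_eq_zero.1 h0 with h2 | h2
  · exfalso
    rw [Finset.sum_boole] at h2
    have : (Finset.univ.filter fun f => m f = m g).card = 0 := by exact_mod_cast h2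
    rw [Finset.card_eq_zero] at this
    have hg : g ∈ Finset.univ.filter fun f => m f = m g := by simp
    rw [this] at hg
    simp at hg
  · exact h2

/-- The exponential vectors are total in the Fock space. -/
theorem eq_zero_of_forall_inner_expVec {n : ℕ} (x : Fock n)
    (h : ∀ u : Modes n, ⟪x, expVec u⟫_ℂ = 0) : x = 0 := by
  have key : ∀ (u : Modes n) (k : ℕ), ⟪x k, tensorPow u k⟫_ℂ = 0 := by
    intro u
    let c : ℕ → ℂ := fun k => ((Real.sqrt (k ! : ℝ) : ℝ) : ℂ)⁻¹ * ⟪x k, tensorPow u k⟫_ℂ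
    have hpow : ∀ (t : ℂ) (k : ℕ), tensorPow (t • u) k = t ^ k • tensorPow u k := by
      intro t k
      apply SymTensor.ext
      intro f
      simp [coord_smul, coord_tensorPow, Finset.prod_mul_distrib]
    have hs : ∀ t : ℂ, HasSum (fun k => t ^ k • c k) 0 := by
      intro t
      have := lp.hasSum_inner (𝕜 := ℂ) x (expVec (t • u))
      rw [h] at this
      refine this.congr_fun fun k => ?_
      rw [expVec_apply, hpow, inner_smul_right, inner_smul_right]
      simp only [c, smul_eq_mul]
      ring
    have hF : HasFPowerSeriesAt (fun _ : ℂ => (0 : ℂ)) (FormalMultilinearSeries.ofScalars ℂ c) 0 := by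
      rw [hasFPowerSeriesAt_iff]
      filter_upwards with t
      refine (hs t).congr_fun fun k => ?_
      rw [FormalMultilinearSeries.coeff_ofScalars]
    have h0 := hF.eq_zero
    intro k
    have hk : c k = 0 := by
      have h1 := FormalMultilinearSeries.coeff_ofScalars (𝕜 := ℂ) (p := c) (n := k)
      rw [h0] at h1
      rw [← h1]
      rfl
    rcases mul_eq_zero.1 hk with h1 | h1
    · exfalso
      have : Real.sqrt (k ! : ℝ) ≠ 0 := by positivity
      exact this (by exact_mod_cast inv_eq_zero.1 h1)
    · exact h1
  apply lp.ext
  funext k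
  apply SymTensor.ext
  intro g
  have := eq_zero_of_forall_sum_mul_prod (fun f => (starRingEnd ℂ) ((x k).coord f))
    (fun σ f => by rw [SymTensor.coord_perm]) (fun u => by
      have := key (WithLp.toLp 2 u) k
      rw [SymTensor.inner_eq] at this
      exact this) g
  rw [map_eq_zero] at this
  exact this

/-- The coherent state vector `|v⟩ = exp(-|v|²/2) e(v)`. -/
def coherent {n : ℕ} (v : Modes n) : Fock n :=
  Complex.exp (-((‖v‖ ^ 2 / 2 : ℝ) : ℂ)) • expVec v

/-! ### Weyl (displacement) operators -/

/-- The vector `exp(-i Im(u†v)) |u + v⟩`. -/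
def displaced {n : ℕ} (u v : Modes n) : Fock n :=
  Complex.exp (-Complex.I * ((⟪u, v⟫_ℂ).im : ℂ)) • coherent (u + v)

theorem inner_displaced {n : ℕ} (u v w : Modes n) :
    ⟪displaced u v, displaced u w⟫_ℂ = ⟪coherent v, coherent w⟫_ℂ := by
  simp only [displaced, coherent, inner_smul_left, inner_smul_right, inner_expVec,
    ← Complex.exp_conj, ← Complex.exp_add]
  congr 1
  simp only [map_mul, map_neg, Complex.conj_ofReal, Complex.conj_I, inner_add_left,
    inner_add_right]
  have hn : ∀ a : Modes n, ((‖u + a‖ ^ 2 / 2 : ℝ) : ℂ)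
      = ((‖u‖ ^ 2 / 2 : ℝ) : ℂ) + ((⟪u, a⟫_ℂ).re : ℂ) + ((‖a‖ ^ 2 / 2 : ℝ) : ℂ) := by
    intro a
    rw [@norm_add_sq ℂ]
    push_cast
    simp
    ring
  have hu : ⟪u, u⟫_ℂ = ((‖u‖ ^ 2 : ℝ) : ℂ) := by
    rw [inner_self_eq_norm_sq_to_K]; push_cast; rfl
  have hv : ⟪v, u⟫_ℂ = ((⟪u, v⟫_ℂ).re : ℂ) - ((⟪u, v⟫_ℂ).im : ℂ) * Complex.I := by
    rw [← inner_conj_symm v u]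
    generalize ⟪u, v⟫_ℂ = b
    apply Complex.ext <;> simp
  have hw : ⟪u, w⟫_ℂ = ((⟪u, w⟫_ℂ).re : ℂ) + ((⟪u, w⟫_ℂ).im : ℂ) * Complex.I :=
    (Complex.re_add_im _).symm
  rw [hn v, hn w, hu, hv]
  generalize ⟪v, w⟫_ℂ = a
  generalize ⟪u, v⟫_ℂ = b at *
  generalize ⟪u, w⟫_ℂ = d at *
  simp
  linear_combination hw

theorem dense_span_coherent (n : ℕ) :
    (Submodule.span ℂ (Set.range (coherent (n := n)))).topologicalClosure = ⊤ := by
  rw [Submodule.topologicalClosure_eq_top_iff, Submodule.eq_bot_iff]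
  intro x hx
  refine eq_zero_of_forall_inner_expVec x fun u => ?_
  have h := (Submodule.mem_orthogonal' _ x).1 hx (coherent u) (Submodule.subset_span ⟨u, rfl⟩)
  rw [coherent, inner_smul_right] at h
  exact (mul_eq_zero.1 h).resolve_left (Complex.exp_ne_zero _)

/-- There is exactly one bounded operator with the prescribed action on coherent states. -/
theorem existsUnique_weyl {n : ℕ} (u : Modes n) :
    ∃! W : Fock n →L[ℂ] Fock n, ∀ v, W (coherent v) = displaced u v := by
  let e : (Modes n →₀ ℂ) →ₗ[ℂ] Fock n := Finsupp.linearCombination ℂ coherent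
  let f : (Modes n →₀ ℂ) →ₗ[ℂ] Fock n := Finsupp.linearCombination ℂ (displaced u)
  have hd : DenseRange e := by
    have h := dense_span_coherent n
    rw [← Submodule.dense_iff_topologicalClosure_eq_top, ← Finsupp.range_linearCombination] at h
    exact h
  have hin : ∀ a : Modes n →₀ ℂ, ⟪f a, f a⟫_ℂ = ⟪e a, e a⟫_ℂ := by
    intro a
    simp only [e, f, Finsupp.linearCombination_apply, Finsupp.sum, sum_inner, inner_sum,
      inner_smul_left, inner_smul_right, inner_displaced]
  have hnorm : ∀ a, ‖f a‖ ≤ 1 * ‖e a‖ := by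
    intro a
    rw [one_mul, @norm_eq_sqrt_re_inner ℂ, @norm_eq_sqrt_re_inner ℂ, hin]
  refine ⟨f.extendOfNorm e, fun v => ?_, fun W hW => ?_⟩
  · have := LinearMap.extendOfNorm_eq hd ⟨1, hnorm⟩ (Finsupp.single v 1)
    simpa [e, f] using this
  · refine (LinearMap.extendOfNorm_unique hd 1 hnorm W ?_).symm
    ext v
    simp [e, f, hW]

/-- The Weyl operator `W(u)`: the bounded operator on the Fock space with
`W(u)|v⟩ = exp(-i Im(u†v)) |u + v⟩` for all `v`. -/
def weyl {n : ℕ} (u : Modes n) : Fock n →L[ℂ] Fock n :=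
  (existsUnique_weyl u).choose

theorem weyl_coherent {n : ℕ} (u v : Modes n) :
    weyl u (coherent v)
      = Complex.exp (-Complex.I * ((⟪u, v⟫_ℂ).im : ℂ)) • coherent (u + v) :=
  (existsUnique_weyl u).choose_spec.1 v

/-! ### States and Gaussian states -/

/-- `T` is a trace class operator with `tr T = c`: the (unconditional) sum of the diagonal matrix
entries is `c` in every orthonormal basis. -/
def HasTrace {n : ℕ} (T : Fock n →L[ℂ] Fock n) (c : ℂ) : Prop :=
  ∀ (ι : Type) (b : HilbertBasis ι ℂ (Fock n)), HasSum (fun i => ⟪b i, T (b i)⟫_ℂ) c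

/-- A state is a positive operator of trace one. -/
def IsState {n : ℕ} (ρ : Fock n →L[ℂ] Fock n) : Prop :=
  ρ.IsPositive ∧ HasTrace ρ 1

/-- A real linear operator on `ℂⁿ` is symmetric if it is symmetric for the real inner product
`Re(u†v)`. -/
def IsRealSymmetric {n : ℕ} (S : Modes n →ₗ[ℝ] Modes n) : Prop :=
  ∀ u v : Modes n, (⟪S u, v⟫_ℂ).re = (⟪u, S v⟫_ℂ).re

/-- `ρ` is a Gaussian state with mean annihilation vector `m` and covariance operator `S`: `ρ` is a
state, `S` is symmetric, and the quantum characteristic function of `ρ` is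
`tr(ρ W(z)) = exp(-2i Im(z†m) - Re(z†Sz))`. -/
def IsGaussianWith {n : ℕ} (ρ : Fock n →L[ℂ] Fock n) (m : Modes n)
    (S : Modes n →ₗ[ℝ] Modes n) : Prop :=
  IsState ρ ∧ IsRealSymmetric S ∧
    ∀ z : Modes n, HasTrace (ρ ∘L weyl z)
      (Complex.exp (-2 * Complex.I * ((⟪z, m⟫_ℂ).im : ℂ) - ((⟪z, S z⟫_ℂ).re : ℂ)))

/-- `ρ` is a (quantum) Gaussian state. -/
def IsGaussianState {n : ℕ} (ρ : Fock n →L[ℂ] Fock n) : Prop :=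
  ∃ m S, IsGaussianWith ρ m S

/-! ### Real `2n`-dimensional phase space -/

/-- The identification of `(x, y) ∈ ℝ^{2n}` with `x + iy ∈ ℂⁿ`. -/
def toModes {n : ℕ} (x : EuclideanSpace ℝ (Fin n ⊕ Fin n)) : Modes n :=
  WithLp.toLp 2 fun j => (x (Sum.inl j) : ℂ) + (x (Sum.inr j) : ℂ) * Complex.I

/-- The `2n × 2n` real matrix of a real linear operator `L` on `ℂⁿ` in the basis
`e₁, …, eₙ, ie₁, …, ieₙ`: if `L(x + iy) = Ex + Fy + i(Gx + Hy)`, it is `[E F; G H]`. -/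
def realMatrix {n : ℕ} (L : Modes n →ₗ[ℝ] Modes n) : Matrix (Fin n ⊕ Fin n) (Fin n ⊕ Fin n) ℝ :=
  Matrix.fromBlocks
    (Matrix.of fun i j => (L (EuclideanSpace.single j 1) i).re)
    (Matrix.of fun i j => (L (EuclideanSpace.single j Complex.I) i).re)
    (Matrix.of fun i j => (L (EuclideanSpace.single j 1) i).im)
    (Matrix.of fun i j => (L (EuclideanSpace.single j Complex.I) i).im)

/-- The standard symplectic matrix `J = [0 I; -I 0]`. -/
def sympJ (n : ℕ) : Matrix (Fin n ⊕ Fin n) (Fin n ⊕ Fin n) ℝ :=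
  Matrix.fromBlocks 0 1 (-1) 0

/-! ### Classical Gaussian states -/

/-- `ρ = ∫ |α⟩⟨α| N_{μ,Σ}(dα)` as a weak operator integral, where `N_{μ,Σ}` is the normal
distribution on `ℝ^{2n} ≅ ℂⁿ` with mean `μ` and covariance matrix `Sigma`, a positive semidefinite
matrix. -/
def IsCoherentMixture {n : ℕ} (ρ : Fock n →L[ℂ] Fock n) (μ : EuclideanSpace ℝ (Fin n ⊕ Fin n))
    (Sigma : Matrix (Fin n ⊕ Fin n) (Fin n ⊕ Fin n) ℝ) : Prop :=
  ∀ x₁ x₂ : Fock n,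
    MeasureTheory.Integrable
      (fun x => ⟪x₁, coherent (toModes x)⟫_ℂ * ⟪coherent (toModes x), x₂⟫_ℂ)
      (ProbabilityTheory.multivariateGaussian μ Sigma) ∧
    ⟪x₁, ρ x₂⟫_ℂ =
      ∫ x, ⟪x₁, coherent (toModes x)⟫_ℂ * ⟪coherent (toModes x), x₂⟫_ℂ
        ∂(ProbabilityTheory.multivariateGaussian μ Sigma)

/-- A classical Gaussian state: a Gaussian state that is a mixture of coherent states with respect
to a (possibly degenerate) normal distribution. -/
def IsClassicalGaussian {n : ℕ} (ρ : Fock n →L[ℂ] Fock n) : Prop :=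
  IsGaussianState ρ ∧ ∃ μ Sigma, Sigma.PosSemidef ∧ IsCoherentMixture ρ μ Sigma

end QuantumGaussian

end

open QuantumGaussian

open scoped InnerProductSpace Nat Topology
open MeasureTheory Matrix QuantumGaussian

namespace QuantumGaussian

/-! ### Continuity and separability -/

/-! The projections `|α⟩⟨α|` are norm-continuous and bounded in `α`, so their Gaussian average
exists as a Bochner integral. Summing over an orthonormal basis under the integral
(`IsCoherentMixture.hasTrace_comp`) gives `tr ρT = ∫ ⟨α|T|α⟩`. With `T = 1` this is the trace. With
`T = W(z)` the integrand is `exp(-|z|²/2)` times a character of phase space, so the integral is a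
classical characteristic function at frequency `2Jξ`, where `ξ` are the real coordinates of `z`. The
prefactor contributes `½I` to the covariance and the classical part contributes `2JᵀΣJ`.

The covariance is unique because the modulus of the characteristic function recovers the quadratic
form of `S`. Hence classicality forces `S - ½I = 2JᵀΣJ ≥ 0`. Conversely, solving this equation for
`Σ` gives a mixture with the characteristic function of `ρ`, and it must be shown that this function
determines the state.

That last point (`IsState.ext_of_hasTrace_weyl`) rests on `integral_weylKernel_smul`: each
`|e(u)⟩⟨e(v)|` is a Gaussian-weighted integral of Weyl operators. Taking the trace against `ρ`
writes `⟨e(v), ρ e(u)⟩` as an integral of the characteristic function. -/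

theorem continuous_expVec (n : ℕ) : Continuous (expVec (n := n)) := by
  rw [continuous_iff_continuousAt]
  intro v
  rw [ContinuousAt, tendsto_iff_norm_sub_tendsto_zero]
  -- The distance depends only on the reproducing kernel `exp⟪u, v⟫`, which is visibly continuous.
  have h : ∀ u : Modes n, ‖expVec u - expVec v‖ = Real.sqrt (Complex.re (Complex.exp ⟪u, u⟫_ℂ
      - Complex.exp ⟪u, v⟫_ℂ - (Complex.exp ⟪v, u⟫_ℂ - Complex.exp ⟪v, v⟫_ℂ))) := by
    intro u
    rw [@norm_eq_sqrt_re_inner ℂ]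
    simp only [inner_sub_left, inner_sub_right, inner_expVec]
    congr 1
    simp
    ring
  simp only [h]
  have hc : Continuous fun u : Modes n => Real.sqrt (Complex.re (Complex.exp ⟪u, u⟫_ℂ
      - Complex.exp ⟪u, v⟫_ℂ - (Complex.exp ⟪v, u⟫_ℂ - Complex.exp ⟪v, v⟫_ℂ))) := by fun_prop
  simpa using hc.tendsto v

theorem continuous_coherent (n : ℕ) : Continuous (coherent (n := n)) := by
  unfold coherent
  have := continuous_expVec n
  fun_prop

theorem norm_coherent {n : ℕ} (v : Modes n) : ‖coherent v‖ = 1 := by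
  have h : ⟪coherent v, coherent v⟫_ℂ = 1 := by
    simp only [coherent, inner_smul_left, inner_smul_right, inner_expVec, ← Complex.exp_conj,
      ← Complex.exp_add]
    rw [inner_self_eq_norm_sq_to_K, ← Complex.exp_zero]
    congr 1
    simp only [map_neg, Complex.conj_ofReal]
    push_cast
    simp
    ring
  rw [@norm_eq_sqrt_re_inner ℂ, h]
  simp

instance separableSpace_fock (n : ℕ) : TopologicalSpace.SeparableSpace (Fock n) := by
  have h := ((TopologicalSpace.isSeparable_range (continuous_coherent n)).span (R := ℂ)).closure
  rw [← Submodule.topologicalClosure_coe, dense_span_coherent] at h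
  exact TopologicalSpace.isSeparable_univ_iff.1 h

/-- Distinct basis vectors are `√2` apart, so the balls of radius `1/2` around them are disjoint.
`HasTrace` allows arbitrary index types, whereas dominated convergence for series needs countable
ones. -/
theorem countable_of_hilbertBasis {ι E : Type*} [NormedAddCommGroup E] [InnerProductSpace ℂ E]
    [TopologicalSpace.SeparableSpace E] (b : HilbertBasis ι ℂ E) : Countable ι := by
  refine Pairwise.countable_of_isOpen_disjoint (s := fun i => Metric.ball (b i) (1 / 2)) ?_
    (fun i => Metric.isOpen_ball) (fun i => ⟨b i, Metric.mem_ball_self (by norm_num)⟩)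
  intro i j hij
  refine Metric.ball_disjoint_ball ?_
  rw [dist_eq_norm]
  have h : ‖b i - b j‖ ^ 2 = 2 := by
    rw [@norm_sub_sq ℂ, b.orthonormal.1 i, b.orthonormal.1 j, b.orthonormal.2 hij]
    norm_num
  nlinarith [norm_nonneg (b i - b j)]

theorem HasTrace.unique {n : ℕ} {T : Fock n →L[ℂ] Fock n} {c d : ℂ} (hc : HasTrace T c)
    (hd : HasTrace T d) : c = d := by
  obtain ⟨w, b, -⟩ := exists_hilbertBasis ℂ (Fock n)
  exact (hc w b).unique (hd w b)

/-! ### Weyl operators -/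

theorem clm_ext_coherent {n : ℕ} {A B : Fock n →L[ℂ] Fock n}
    (h : ∀ v, A (coherent v) = B (coherent v)) : A = B := by
  refine ContinuousLinearMap.ext_on (s := Set.range (coherent (n := n))) ?_ ?_
  · rw [Submodule.dense_iff_topologicalClosure_eq_top]
    exact dense_span_coherent n
  · rintro _ ⟨v, rfl⟩
    exact h v

/-- The two phases cancel because `u†u` is real. This supplies the surjectivity in `weylUnitary`. -/
theorem weyl_comp_weyl_neg {n : ℕ} (u : Modes n) :
    weyl u ∘L weyl (-u) = ContinuousLinearMap.id ℂ (Fock n) := by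
  refine clm_ext_coherent fun v => ?_
  rw [ContinuousLinearMap.comp_apply, weyl_coherent, map_smul, weyl_coherent, smul_smul,
    ← Complex.exp_add, add_neg_cancel_left]
  have hu : (⟪u, u⟫_ℂ).im = 0 := inner_self_im (𝕜 := ℂ) u
  rw [inner_add_right, inner_neg_right, inner_neg_left, Complex.add_im, Complex.neg_im,
    Complex.neg_im, hu]
  simp

theorem inner_weyl_weyl {n : ℕ} (u : Modes n) (x y : Fock n) :
    ⟪weyl u x, weyl u y⟫_ℂ = ⟪x, y⟫_ℂ := by
  have h : (ContinuousLinearMap.adjoint (weyl u)) ∘L weyl u = ContinuousLinearMap.id ℂ _ := by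
    refine clm_ext_coherent fun v => ?_
    rw [← sub_eq_zero]
    refine eq_zero_of_forall_inner_expVec _ fun w => ?_
    have hw : expVec w = Complex.exp (((‖w‖ ^ 2 / 2 : ℝ) : ℂ)) • coherent w := by
      rw [coherent, smul_smul, ← Complex.exp_add]
      simp
    rw [hw, inner_smul_right, inner_sub_left, ContinuousLinearMap.comp_apply,
      ContinuousLinearMap.adjoint_inner_left, weyl_coherent, weyl_coherent]
    have := inner_displaced u v w
    simp only [displaced] at this
    rw [this]
    simp
  rw [← ContinuousLinearMap.adjoint_inner_left, ← ContinuousLinearMap.comp_apply, h]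
  rfl

/-- The Weyl operator as a unitary. -/
noncomputable def weylUnitary {n : ℕ} (u : Modes n) : Fock n ≃ₗᵢ[ℂ] Fock n :=
  LinearIsometryEquiv.ofSurjective
    ((weyl u).toLinearMap.isometryOfInner (inner_weyl_weyl u))
    fun y => ⟨weyl (-u) y, DFunLike.congr_fun (weyl_comp_weyl_neg u) y⟩

theorem weylUnitary_apply {n : ℕ} (u : Modes n) (x : Fock n) : weylUnitary u x = weyl u x := rfl

theorem norm_weyl_apply {n : ℕ} (u : Modes n) (x : Fock n) : ‖weyl u x‖ = ‖x‖ :=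
  (weylUnitary u).norm_map x

/-- Strong continuity is explicit on the span of coherent states. Since every `weyl u` is isometric,
approximating `y` from that span is uniform in `u`. -/
theorem continuous_weyl_apply {n : ℕ} (y : Fock n) : Continuous fun u : Modes n => weyl u y := by
  have hspan : ∀ x ∈ Submodule.span ℂ (Set.range (coherent (n := n))),
      Continuous fun u : Modes n => weyl u x := by
    intro x hx
    induction hx using Submodule.span_induction with
    | mem x hx =>
      obtain ⟨v, rfl⟩ := hx
      simp only [weyl_coherent]
      have := continuous_coherent n
      fun_prop
    | zero => simpa using continuous_const
    | add x y _ _ hx hy => simp only [map_add]; exact hx.add hy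
    | smul c x _ hx => simp only [map_smul]; exact hx.const_smul c
  refine continuous_of_uniform_approx_of_continuous fun U hU => ?_
  obtain ⟨ε, hε, hU⟩ := Metric.mem_uniformity_dist.1 hU
  have hy : y ∈ (Submodule.span ℂ (Set.range (coherent (n := n)))).topologicalClosure := by
    rw [dense_span_coherent]
    trivial
  obtain ⟨x, hx, hxy⟩ := Metric.mem_closure_iff.1 hy ε hε
  refine ⟨_, hspan x hx, fun u => hU ?_⟩
  rwa [dist_eq_norm, ← map_sub, norm_weyl_apply, ← dist_eq_norm]

/-- The phase of `W(z)` and the phase of the overlap `⟨v|z+v⟩` coincide, whence the factor 2; the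
modulus of the overlap is independent of `v`. -/
theorem inner_coherent_weyl_coherent {n : ℕ} (z v : Modes n) :
    ⟪coherent v, weyl z (coherent v)⟫_ℂ
      = Complex.exp (-2 * Complex.I * ((⟪z, v⟫_ℂ).im : ℂ) - ((‖z‖ ^ 2 / 2 : ℝ) : ℂ)) := by
  rw [weyl_coherent]
  simp only [coherent, inner_smul_left, inner_smul_right, inner_expVec, ← Complex.exp_conj,
    ← Complex.exp_add]
  congr 1
  have hv : ⟪v, z⟫_ℂ = ((⟪z, v⟫_ℂ).re : ℂ) - ((⟪z, v⟫_ℂ).im : ℂ) * Complex.I := by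
    rw [← inner_conj_symm v z]
    generalize ⟪z, v⟫_ℂ = b
    apply Complex.ext <;> simp
  have hvv : ⟪v, v⟫_ℂ = ((‖v‖ ^ 2 : ℝ) : ℂ) := by
    rw [inner_self_eq_norm_sq_to_K]; push_cast; rfl
  rw [inner_add_right, hv, hvv, @norm_add_sq ℂ]
  simp only [map_neg, Complex.conj_ofReal, RCLike.re_to_complex]
  push_cast
  ring

/-! ### Mixtures of coherent states -/

theorem continuous_toModes (n : ℕ) : Continuous (toModes (n := n)) := by
  unfold toModes
  fun_prop

theorem integrable_inner_coherent_mul {n : ℕ}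
    (P : Measure (EuclideanSpace ℝ (Fin n ⊕ Fin n))) [IsFiniteMeasure P] (x₁ x₂ : Fock n) :
    Integrable (fun x => ⟪x₁, coherent (toModes x)⟫_ℂ * ⟪coherent (toModes x), x₂⟫_ℂ) P := by
  have hc := (continuous_coherent n).comp (continuous_toModes n)
  refine Integrable.of_bound (C := ‖x₁‖ * ‖x₂‖) (Continuous.aestronglyMeasurable ?_)
    (Filter.Eventually.of_forall fun x => ?_)
  · exact (continuous_const.inner hc).mul (hc.inner continuous_const)
  · rw [norm_mul]
    have h1 := norm_inner_le_norm (𝕜 := ℂ) x₁ (coherent (toModes x))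
    have h2 := norm_inner_le_norm (𝕜 := ℂ) (coherent (toModes x)) x₂
    rw [norm_coherent, mul_one] at h1
    rw [norm_coherent, one_mul] at h2
    gcongr

theorem exists_isCoherentMixture {n : ℕ} (μ : EuclideanSpace ℝ (Fin n ⊕ Fin n))
    (Sigma : Matrix (Fin n ⊕ Fin n) (Fin n ⊕ Fin n) ℝ) :
    ∃ ρ : Fock n →L[ℂ] Fock n, IsCoherentMixture ρ μ Sigma := by
  let P := ProbabilityTheory.multivariateGaussian μ Sigma
  let R : EuclideanSpace ℝ (Fin n ⊕ Fin n) → (Fock n →L[ℂ] Fock n) := fun x =>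
    InnerProductSpace.rankOne ℂ (coherent (toModes x)) (coherent (toModes x))
  have hc : Continuous fun x : EuclideanSpace ℝ (Fin n ⊕ Fin n) => coherent (toModes x) :=
    (continuous_coherent n).comp (continuous_toModes n)
  have hR : Continuous R := by
    exact ((ContinuousLinearMap.smulRightL ℂ _ _).continuous.comp
      ((innerSL ℂ).continuous.comp hc)).clm_apply hc
  have hint : Integrable R P := by
    refine Integrable.of_bound (C := 1) hR.aestronglyMeasurable
      (Filter.Eventually.of_forall fun x => ?_)
    simp [R, norm_coherent]
  refine ⟨∫ x, R x ∂P, fun x₁ x₂ => ⟨integrable_inner_coherent_mul P x₁ x₂, ?_⟩⟩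
  rw [ContinuousLinearMap.integral_apply hint, ← integral_inner (hint.apply_continuousLinearMap x₂)]
  refine integral_congr_ae (Filter.Eventually.of_forall fun x => ?_)
  simp [R, inner_smul_right, mul_comm]

/-- For fixed `α`, the diagonal terms are `⟨T†α, bᵢ⟩⟨bᵢ, α⟩`, which Parseval sums to `⟨α, Tα⟩`;
dominated convergence exchanges this sum with the integral. -/
theorem IsCoherentMixture.hasTrace_comp {n : ℕ} {ρ : Fock n →L[ℂ] Fock n}
    {μ : EuclideanSpace ℝ (Fin n ⊕ Fin n)} {Sigma : Matrix (Fin n ⊕ Fin n) (Fin n ⊕ Fin n) ℝ}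
    (h : IsCoherentMixture ρ μ Sigma) (T : Fock n →L[ℂ] Fock n) :
    HasTrace (ρ ∘L T) (∫ x, ⟪coherent (toModes x), T (coherent (toModes x))⟫_ℂ
      ∂(ProbabilityTheory.multivariateGaussian μ Sigma)) := by
  intro ι b
  have := countable_of_hilbertBasis b
  set P := ProbabilityTheory.multivariateGaussian μ Sigma
  simp only [ContinuousLinearMap.comp_apply, (h _ _).2]
  have hsq : ∀ y : Fock n, HasSum (fun i => ‖⟪b i, y⟫_ℂ‖ ^ 2) (‖y‖ ^ 2) := by
    intro y
    have h1 := Complex.hasSum_re (b.hasSum_inner_mul_inner y y)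
    rw [inner_self_eq_norm_sq_to_K] at h1
    convert! h1 using 1
    · funext i
      rw [← inner_conj_symm y, Complex.conj_mul', ← Complex.ofReal_pow, Complex.ofReal_re]
    · norm_cast
  have hadj : ∀ (i : ι) (x : Fock n), ⟪x, T (b i)⟫_ℂ
      = ⟪ContinuousLinearMap.adjoint T x, b i⟫_ℂ := fun i x =>
    (ContinuousLinearMap.adjoint_inner_left T (b i) x).symm
  -- A product is bounded by the sum of squares, and these sum over `i` to `1 + ‖T†α‖²`, which is
  -- bounded in `α`.
  let bound : ι → EuclideanSpace ℝ (Fin n ⊕ Fin n) → ℝ := fun i x =>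
    ‖⟪b i, coherent (toModes x)⟫_ℂ‖ ^ 2
      + ‖⟪b i, ContinuousLinearMap.adjoint T (coherent (toModes x))⟫_ℂ‖ ^ 2
  have hb : ∀ x, HasSum (fun i => bound i x)
      (‖coherent (toModes x)‖ ^ 2 + ‖ContinuousLinearMap.adjoint T (coherent (toModes x))‖ ^ 2) :=
    fun x => (hsq _).add (hsq _)
  have hc : Continuous fun x : EuclideanSpace ℝ (Fin n ⊕ Fin n) => coherent (toModes x) :=
    (continuous_coherent n).comp (continuous_toModes n)
  refine hasSum_integral_of_dominated_convergence bound
    (fun i => (integrable_inner_coherent_mul P _ _).aestronglyMeasurable)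
    (fun i => Filter.Eventually.of_forall fun x => ?_)
    (Filter.Eventually.of_forall fun x => (hb x).summable) ?_
    (Filter.Eventually.of_forall fun x => ?_)
  · rw [norm_mul, hadj, norm_inner_symm (ContinuousLinearMap.adjoint T _)]
    simp only [bound]
    nlinarith [sq_nonneg (‖⟪b i, coherent (toModes x)⟫_ℂ‖
      - ‖⟪b i, ContinuousLinearMap.adjoint T (coherent (toModes x))⟫_ℂ‖),
      sq_nonneg (‖⟪b i, coherent (toModes x)⟫_ℂ‖),
      sq_nonneg (‖⟪b i, ContinuousLinearMap.adjoint T (coherent (toModes x))⟫_ℂ‖)]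
  · simp only [(hb _).tsum_eq]
    refine Integrable.of_bound (C := 1 + ‖ContinuousLinearMap.adjoint T‖ ^ 2)
      (Continuous.aestronglyMeasurable (by fun_prop)) (Filter.Eventually.of_forall fun x => ?_)
    rw [Real.norm_of_nonneg (by positivity), norm_coherent]
    have := (ContinuousLinearMap.adjoint T).le_opNorm (coherent (toModes x))
    rw [norm_coherent, mul_one] at this
    rw [one_pow]
    gcongr
  · have := b.hasSum_inner_mul_inner (ContinuousLinearMap.adjoint T (coherent (toModes x)))
      (coherent (toModes x))
    rw [ContinuousLinearMap.adjoint_inner_left] at this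
    refine this.congr_fun fun i => ?_
    rw [hadj, mul_comm]

theorem IsCoherentMixture.isPositive {n : ℕ} {ρ : Fock n →L[ℂ] Fock n}
    {μ : EuclideanSpace ℝ (Fin n ⊕ Fin n)} {Sigma : Matrix (Fin n ⊕ Fin n) (Fin n ⊕ Fin n) ℝ}
    (h : IsCoherentMixture ρ μ Sigma) : ρ.IsPositive := by
  rw [ContinuousLinearMap.isPositive_iff_complex]
  intro x
  have hx : ⟪ρ x, x⟫_ℂ = ((∫ y, ‖⟪x, coherent (toModes y)⟫_ℂ‖ ^ 2
      ∂(ProbabilityTheory.multivariateGaussian μ Sigma) : ℝ) : ℂ) := by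
    rw [← Complex.conj_ofReal, ← inner_conj_symm, (h x x).2, ← integral_complex_ofReal]
    congr 1
    refine integral_congr_ae (Filter.Eventually.of_forall fun y => ?_)
    simp only
    rw [← inner_conj_symm (coherent (toModes y)) x, Complex.mul_conj', Complex.ofReal_pow]
  rw [hx]
  refine ⟨by simp, ?_⟩
  simp only [RCLike.re_to_complex, Complex.ofReal_re]
  positivity

theorem IsCoherentMixture.isState {n : ℕ} {ρ : Fock n →L[ℂ] Fock n}
    {μ : EuclideanSpace ℝ (Fin n ⊕ Fin n)} {Sigma : Matrix (Fin n ⊕ Fin n) (Fin n ⊕ Fin n) ℝ}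
    (h : IsCoherentMixture ρ μ Sigma) : IsState ρ := by
  refine ⟨h.isPositive, ?_⟩
  have h1 := h.hasTrace_comp (ContinuousLinearMap.id ℂ (Fock n))
  simpa [inner_self_eq_norm_sq_to_K, norm_coherent] using h1

/-! ### Phase space coordinates -/

theorem re_inner_toModes {n : ℕ} (ξ : EuclideanSpace ℝ (Fin n ⊕ Fin n)) (w : Modes n) :
    (⟪toModes ξ, w⟫_ℂ).re = ∑ i, (ξ (Sum.inl i) * (w i).re + ξ (Sum.inr i) * (w i).im) := by
  rw [PiLp.inner_apply, Complex.re_sum]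
  refine Finset.sum_congr rfl fun i _ => ?_
  simp [toModes]
  ring

theorem im_inner_toModes {n : ℕ} (ξ : EuclideanSpace ℝ (Fin n ⊕ Fin n)) (w : Modes n) :
    (⟪toModes ξ, w⟫_ℂ).im = ∑ i, (ξ (Sum.inl i) * (w i).im - ξ (Sum.inr i) * (w i).re) := by
  rw [PiLp.inner_apply, Complex.im_sum]
  refine Finset.sum_congr rfl fun i _ => ?_
  simp [toModes]
  ring

/-- The real coordinates `(x, y)` of `x + iy`. -/
noncomputable def coords {n : ℕ} (z : Modes n) : EuclideanSpace ℝ (Fin n ⊕ Fin n) :=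
  WithLp.toLp 2 (Sum.elim (fun i => (z i).re) fun i => (z i).im)

theorem toModes_coords {n : ℕ} (z : Modes n) : toModes (coords z) = z := by
  ext i
  simp [toModes, coords]

theorem toModes_eq_sum {n : ℕ} (ξ : EuclideanSpace ℝ (Fin n ⊕ Fin n)) :
    toModes ξ = ∑ j, (ξ (Sum.inl j) • EuclideanSpace.single j (1 : ℂ)
      + ξ (Sum.inr j) • EuclideanSpace.single j Complex.I) := by
  ext i
  simp [toModes, Finset.sum_add_distrib, Pi.single_apply]

theorem re_inner_toModes_map {n : ℕ} (S : Modes n →ₗ[ℝ] Modes n)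
    (ξ η : EuclideanSpace ℝ (Fin n ⊕ Fin n)) :
    (⟪toModes ξ, S (toModes η)⟫_ℂ).re = ξ.ofLp ⬝ᵥ realMatrix S *ᵥ η.ofLp := by
  rw [re_inner_toModes, toModes_eq_sum η]
  simp only [dotProduct, mulVec, Fintype.sum_sum_type, realMatrix, fromBlocks_apply₁₁,
    fromBlocks_apply₁₂, fromBlocks_apply₂₁, fromBlocks_apply₂₂, of_apply, ← Finset.sum_add_distrib]
  refine Finset.sum_congr rfl fun i _ => ?_
  simp only [map_sum, map_add, map_smul, WithLp.ofLp_sum, Finset.sum_apply, WithLp.ofLp_add,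
    Pi.add_apply, WithLp.ofLp_smul, Pi.smul_apply, Complex.re_sum, Complex.im_sum, Complex.add_re,
    Complex.add_im, Complex.smul_re, Complex.smul_im, smul_eq_mul]
  congr 1 <;> congr 1 <;> exact Finset.sum_congr rfl fun j _ => by ring

theorem im_inner_toModes_toModes {n : ℕ} (ξ x : EuclideanSpace ℝ (Fin n ⊕ Fin n)) :
    (⟪toModes ξ, toModes x⟫_ℂ).im = -(sympJ n *ᵥ ξ.ofLp ⬝ᵥ x.ofLp) := by
  rw [im_inner_toModes]
  simp [dotProduct, mulVec, Fintype.sum_sum_type, sympJ, toModes, Matrix.one_apply,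
    Finset.sum_add_distrib, sub_eq_add_neg]

theorem norm_toModes_sq {n : ℕ} (ξ : EuclideanSpace ℝ (Fin n ⊕ Fin n)) :
    ‖toModes ξ‖ ^ 2 = ξ.ofLp ⬝ᵥ ξ.ofLp := by
  have h : (⟪toModes ξ, toModes ξ⟫_ℂ).re = ‖toModes ξ‖ ^ 2 :=
    inner_self_eq_norm_sq (𝕜 := ℂ) (toModes ξ)
  rw [← h, re_inner_toModes]
  simp [dotProduct, Fintype.sum_sum_type, toModes, Finset.sum_add_distrib]

theorem isSymm_realMatrix {n : ℕ} {S : Modes n →ₗ[ℝ] Modes n} (hS : IsRealSymmetric S) :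
    (realMatrix S).IsSymm := by
  ext i j
  have h : ∀ ξ η : EuclideanSpace ℝ (Fin n ⊕ Fin n),
      ξ.ofLp ⬝ᵥ realMatrix S *ᵥ η.ofLp = η.ofLp ⬝ᵥ realMatrix S *ᵥ ξ.ofLp := by
    intro ξ η
    rw [← re_inner_toModes_map, ← re_inner_toModes_map, ← hS, ← inner_conj_symm, Complex.conj_re]
  simpa [Matrix.mulVec_single_one] using h (EuclideanSpace.single j 1) (EuclideanSpace.single i 1)

/-- The real linear operator on `ℂⁿ` with a given real matrix. -/
noncomputable def opOfMatrix {n : ℕ} (A : Matrix (Fin n ⊕ Fin n) (Fin n ⊕ Fin n) ℝ) :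
    Modes n →ₗ[ℝ] Modes n where
  toFun z := toModes (WithLp.toLp 2 (A *ᵥ (coords z).ofLp))
  map_add' z w := by
    have h : (coords (z + w)).ofLp = (coords z).ofLp + (coords w).ofLp := by
      ext i
      cases i <;> simp [coords]
    ext i
    simp [h, mulVec_add, toModes]
    ring
  map_smul' c z := by
    have h : (coords (c • z)).ofLp = c • (coords z).ofLp := by
      ext i
      cases i <;> simp [coords]
    ext i
    simp [h, mulVec_smul, toModes]
    ring

theorem realMatrix_opOfMatrix {n : ℕ} (A : Matrix (Fin n ⊕ Fin n) (Fin n ⊕ Fin n) ℝ) :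
    realMatrix (opOfMatrix A) = A := by
  have h1 : ∀ j : Fin n, (coords (EuclideanSpace.single j (1 : ℂ))).ofLp
      = Pi.single (Sum.inl j) 1 := by
    intro j
    ext i
    cases i with
    | inl i => by_cases h : i = j <;> simp [coords, h]
    | inr i => by_cases h : i = j <;> simp [coords, h]
  have h2 : ∀ j : Fin n, (coords (EuclideanSpace.single j Complex.I)).ofLp
      = Pi.single (Sum.inr j) 1 := by
    intro j
    ext i
    cases i with
    | inl i => by_cases h : i = j <;> simp [coords, h]
    | inr i => by_cases h : i = j <;> simp [coords, h]
  ext i j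
  cases i <;> cases j <;> simp [realMatrix, opOfMatrix, h1, h2, toModes]

theorem isRealSymmetric_opOfMatrix {n : ℕ} {A : Matrix (Fin n ⊕ Fin n) (Fin n ⊕ Fin n) ℝ}
    (hA : A.IsSymm) : IsRealSymmetric (opOfMatrix A) := by
  intro u v
  rw [← inner_conj_symm, Complex.conj_re, ← toModes_coords u, ← toModes_coords v,
    re_inner_toModes_map, re_inner_toModes_map, realMatrix_opOfMatrix, dotProduct_mulVec,
    ← mulVec_transpose, hA.eq, dotProduct_comm]

theorem ext_of_quadratic_form {ι : Type*} [Fintype ι] {A B : Matrix ι ι ℝ} (hA : A.IsSymm)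
    (hB : B.IsSymm) (h : ∀ v, v ⬝ᵥ A *ᵥ v = v ⬝ᵥ B *ᵥ v) : A = B := by
  classical
  ext i j
  have hi := h (Pi.single i 1)
  have hj := h (Pi.single j 1)
  have hij := h (Pi.single i 1 + Pi.single j 1)
  have h1 := hA.apply i j
  have h2 := hB.apply i j
  simp [mulVec_add, add_dotProduct] at hi hj hij
  linarith

/-! ### The symplectic matrix -/

theorem sympJ_transpose_mul (n : ℕ) : (sympJ n)ᵀ * sympJ n = 1 := by
  simp [sympJ, fromBlocks_transpose, fromBlocks_multiply]

/-! ### Mixtures are Gaussian -/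

/-- The covariance matrix of the mixture of coherent states with classical covariance `Sigma`. -/
noncomputable def mixtureCov {n : ℕ} (Sigma : Matrix (Fin n ⊕ Fin n) (Fin n ⊕ Fin n) ℝ) :
    Matrix (Fin n ⊕ Fin n) (Fin n ⊕ Fin n) ℝ :=
  (1 / 2 : ℝ) • (1 : Matrix (Fin n ⊕ Fin n) (Fin n ⊕ Fin n) ℝ)
    + (2 : ℝ) • ((sympJ n).transpose * Sigma * sympJ n)

theorem posSemidef_transpose_mul_mul {n : ℕ} {Sigma : Matrix (Fin n ⊕ Fin n) (Fin n ⊕ Fin n) ℝ}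
    (hS : Sigma.PosSemidef) : ((sympJ n).transpose * Sigma * sympJ n).PosSemidef := by
  simpa [conjTranspose_eq_transpose_of_trivial] using hS.conjTranspose_mul_mul_same (sympJ n)

theorem posSemidef_mul_mul_transpose {n : ℕ} {B : Matrix (Fin n ⊕ Fin n) (Fin n ⊕ Fin n) ℝ}
    (hB : B.PosSemidef) : (sympJ n * B * (sympJ n).transpose).PosSemidef := by
  simpa [conjTranspose_eq_transpose_of_trivial] using hB.mul_mul_conjTranspose_same (sympJ n)

theorem isSymm_mixtureCov {n : ℕ} {Sigma : Matrix (Fin n ⊕ Fin n) (Fin n ⊕ Fin n) ℝ}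
    (hS : Sigma.PosSemidef) : (mixtureCov Sigma).IsSymm := by
  have h := (posSemidef_transpose_mul_mul hS).isHermitian
  rw [IsHermitian, conjTranspose_eq_transpose_of_trivial] at h
  rw [IsSymm, mixtureCov, transpose_add, transpose_smul, transpose_smul, h, transpose_one]

theorem integral_inner_coherent_weyl {n : ℕ} (μ : EuclideanSpace ℝ (Fin n ⊕ Fin n))
    {Sigma : Matrix (Fin n ⊕ Fin n) (Fin n ⊕ Fin n) ℝ} (hS : Sigma.PosSemidef) (z : Modes n) :
    ∫ x, ⟪coherent (toModes x), weyl z (coherent (toModes x))⟫_ℂ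
      ∂(ProbabilityTheory.multivariateGaussian μ Sigma)
      = Complex.exp (-2 * Complex.I * ((⟪z, toModes μ⟫_ℂ).im : ℂ)
        - ((⟪z, opOfMatrix (mixtureCov Sigma) z⟫_ℂ).re : ℂ)) := by
  obtain ⟨ξ, rfl⟩ : ∃ ξ, z = toModes ξ := ⟨coords z, (toModes_coords z).symm⟩
  -- Chosen so that the phase `-2 Im(z†α)` is the real inner product of `α` with `t`.
  let t : EuclideanSpace ℝ (Fin n ⊕ Fin n) := WithLp.toLp 2 ((2 : ℝ) • sympJ n *ᵥ ξ.ofLp)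
  have ht : ∀ x : EuclideanSpace ℝ (Fin n ⊕ Fin n),
      ⟪x, t⟫_ℝ = -2 * (⟪toModes ξ, toModes x⟫_ℂ).im := by
    intro x
    rw [EuclideanSpace.inner_eq_star_dotProduct, im_inner_toModes_toModes]
    simp [t]
  have hchar := ProbabilityTheory.charFun_multivariateGaussian (μ := μ) hS t
  rw [charFun_apply] at hchar
  have hint : ∀ x : EuclideanSpace ℝ (Fin n ⊕ Fin n),
      ⟪coherent (toModes x), weyl (toModes ξ) (coherent (toModes x))⟫_ℂ
        = Complex.exp (-((‖toModes ξ‖ ^ 2 / 2 : ℝ) : ℂ))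
          * Complex.exp (((⟪x, t⟫_ℝ : ℝ) : ℂ) * Complex.I) := by
    intro x
    rw [inner_coherent_weyl_coherent, ← Complex.exp_add, ht]
    congr 1
    push_cast
    ring
  simp only [hint]
  rw [integral_const_mul, hchar, ← Complex.exp_add, real_inner_comm, ht, re_inner_toModes_map,
    realMatrix_opOfMatrix, norm_toModes_sq]
  have hq : ξ.ofLp ⬝ᵥ mixtureCov Sigma *ᵥ ξ.ofLp
      = ξ.ofLp ⬝ᵥ ξ.ofLp / 2 + t.ofLp ⬝ᵥ Sigma *ᵥ t.ofLp / 2 := by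
    simp only [mixtureCov, t, add_mulVec, smul_mulVec, one_mulVec, dotProduct_add, dotProduct_smul,
      ← mulVec_mulVec, mulVec_smul, smul_dotProduct, smul_eq_mul]
    rw [dotProduct_mulVec ξ.ofLp, vecMul_transpose]
    ring
  rw [hq]
  congr 1
  push_cast
  ring

theorem IsCoherentMixture.isGaussianWith {n : ℕ} {ρ : Fock n →L[ℂ] Fock n}
    {μ : EuclideanSpace ℝ (Fin n ⊕ Fin n)} {Sigma : Matrix (Fin n ⊕ Fin n) (Fin n ⊕ Fin n) ℝ}
    (hS : Sigma.PosSemidef) (h : IsCoherentMixture ρ μ Sigma) :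
    IsGaussianWith ρ (toModes μ) (opOfMatrix (mixtureCov Sigma)) := by
  refine ⟨h.isState, isRealSymmetric_opOfMatrix (isSymm_mixtureCov hS), fun z => ?_⟩
  rw [← integral_inner_coherent_weyl μ hS z]
  exact h.hasTrace_comp _

/-- Taking moduli removes the mean from the characteristic function and leaves the quadratic form,
which fixes a symmetric matrix by polarization. -/
theorem IsGaussianWith.realMatrix_eq {n : ℕ} {ρ : Fock n →L[ℂ] Fock n} {m m' : Modes n}
    {S S' : Modes n →ₗ[ℝ] Modes n} (h : IsGaussianWith ρ m S) (h' : IsGaussianWith ρ m' S') :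
    realMatrix S = realMatrix S' := by
  refine ext_of_quadratic_form (isSymm_realMatrix h.2.1) (isSymm_realMatrix h'.2.1) fun v => ?_
  have hv := (h.2.2 (toModes (WithLp.toLp 2 v))).unique (h'.2.2 (toModes (WithLp.toLp 2 v)))
  have hn := congrArg norm hv
  rw [Complex.norm_exp, Complex.norm_exp, Real.exp_eq_exp] at hn
  rw [← WithLp.ofLp_toLp 2 v, ← re_inner_toModes_map, ← re_inner_toModes_map]
  simpa using hn

/-! ### A state is determined by its quantum characteristic function -/

theorem coherent_eq_smul {n : ℕ} (v : Modes n) :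
    coherent v = Complex.exp (-((‖v‖ ^ 2 / 2 : ℝ) : ℂ)) • expVec v := rfl

theorem clm_ext_expVec {n : ℕ} {A B : Fock n →L[ℂ] Fock n}
    (h : ∀ v, A (expVec v) = B (expVec v)) : A = B :=
  clm_ext_coherent fun v => by rw [coherent_eq_smul, map_smul, map_smul, h]

theorem ext_inner_expVec {n : ℕ} {x y : Fock n}
    (h : ∀ u : Modes n, ⟪expVec u, x⟫_ℂ = ⟪expVec u, y⟫_ℂ) : x = y := by
  rw [← sub_eq_zero]
  refine eq_zero_of_forall_inner_expVec _ fun u => ?_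
  rw [← inner_conj_symm, inner_sub_right, h, sub_self, map_zero]

/-- Changing normalization contributes `-Re⟪w, v⟫`, which completes the phase `-i Im⟪w, v⟫` to the
full inner product. -/
theorem weyl_expVec {n : ℕ} (w v : Modes n) :
    weyl w (expVec v)
      = Complex.exp (-((‖w‖ ^ 2 / 2 : ℝ) : ℂ) - ⟪w, v⟫_ℂ) • expVec (w + v) := by
  have hv : expVec v = Complex.exp (((‖v‖ ^ 2 / 2 : ℝ) : ℂ)) • coherent v := by
    rw [coherent, smul_smul, ← Complex.exp_add]
    simp
  rw [hv, map_smul, weyl_coherent, coherent_eq_smul, smul_smul, smul_smul, ← Complex.exp_add,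
    ← Complex.exp_add, @norm_add_sq ℂ]
  congr 2
  nth_rewrite 3 [← Complex.re_add_im ⟪w, v⟫_ℂ]
  simp only [RCLike.re_to_complex]
  push_cast
  ring

theorem inner_expVec_weyl_expVec {n : ℕ} (u w v : Modes n) :
    ⟪expVec u, weyl w (expVec v)⟫_ℂ
      = Complex.exp (-((‖w‖ ^ 2 / 2 : ℝ) : ℂ) - ⟪w, v⟫_ℂ + ⟪u, w⟫_ℂ + ⟪u, v⟫_ℂ) := by
  rw [weyl_expVec, inner_smul_right, inner_expVec, ← Complex.exp_add, inner_add_right]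
  congr 1
  ring

/-! ### Gaussian integrals over phase space and Weyl inversion -/

/-- The point of `ℂⁿ` with given real coordinates, as a function on `ℝ^{2n}` with its product
measure. -/
noncomputable def phasePoint {n : ℕ} (ξ : Fin n ⊕ Fin n → ℝ) : Modes n :=
  toModes (WithLp.toLp 2 ξ)

theorem continuous_phasePoint (n : ℕ) : Continuous (phasePoint (n := n)) :=
  (continuous_toModes n).comp (PiLp.continuous_toLp 2 _)

theorem norm_phasePoint_sq {n : ℕ} (ξ : Fin n ⊕ Fin n → ℝ) :
    ((‖phasePoint ξ‖ ^ 2 : ℝ) : ℂ) = ∑ i, (ξ i : ℂ) ^ 2 := by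
  rw [phasePoint, norm_toModes_sq, dotProduct]
  push_cast
  exact Finset.sum_congr rfl fun i _ => (sq _).symm

/-- The coefficients of the linear form `w ↦ a†w + w†b` in real coordinates. -/
noncomputable def linCoeff {n : ℕ} (a b : Modes n) : Fin n ⊕ Fin n → ℂ :=
  Sum.elim (fun j => (starRingEnd ℂ) (a j) + b j)
    fun j => Complex.I * ((starRingEnd ℂ) (a j) - b j)

theorem inner_add_inner_phasePoint {n : ℕ} (a b : Modes n) (ξ : Fin n ⊕ Fin n → ℝ) :
    ⟪a, phasePoint ξ⟫_ℂ + ⟪phasePoint ξ, b⟫_ℂ = ∑ i, linCoeff a b i * ξ i := by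
  simp only [PiLp.inner_apply, RCLike.inner_apply, Fintype.sum_sum_type, linCoeff, Sum.elim_inl,
    Sum.elim_inr, ← Finset.sum_add_distrib, phasePoint, toModes, map_add, map_mul,
    Complex.conj_ofReal, Complex.conj_I]
  exact Finset.sum_congr rfl fun j _ => by ring

/-- Coordinatewise this is `(ā + b)² - (ā - b)² = 4āb`. The 4 cancels the denominator in the
Gaussian integral formula. -/
theorem sum_linCoeff_sq {n : ℕ} (a b : Modes n) :
    ∑ i, linCoeff a b i ^ 2 = 4 * ⟪a, b⟫_ℂ := by
  simp only [PiLp.inner_apply, RCLike.inner_apply, Fintype.sum_sum_type, linCoeff, Sum.elim_inl,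
    Sum.elim_inr, ← Finset.sum_add_distrib, Finset.mul_sum]
  refine Finset.sum_congr rfl fun j _ => ?_
  rw [mul_pow, Complex.I_sq]
  ring

theorem integral_exp_neg_normSq_add {n : ℕ} (a b : Modes n) :
    ∫ ξ : Fin n ⊕ Fin n → ℝ, Complex.exp (-((‖phasePoint ξ‖ ^ 2 : ℝ) : ℂ)
      + (⟪a, phasePoint ξ⟫_ℂ + ⟪phasePoint ξ, b⟫_ℂ))
      = (Real.pi : ℂ) ^ n * Complex.exp ⟪a, b⟫_ℂ := by
  have h := GaussianFourier.integral_cexp_neg_mul_sum_add (b := 1) (by simp) (linCoeff a b)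
  simp only [norm_phasePoint_sq, inner_add_inner_phasePoint]
  simp only [neg_one_mul, div_one, mul_one, sum_linCoeff_sq] at h
  rw [h, mul_div_cancel_left₀ _ (by norm_num)]
  congr 1
  -- The real dimension is `2n`, so the power `π^(dim/2)` is `π^n`.
  rw [Fintype.card_sum, Fintype.card_fin, ← Complex.cpow_natCast]
  congr 1
  push_cast
  ring

/-- The function `w ↦ conj ⟨e(u), W(w) e(v)⟩`. -/
noncomputable def weylKernel {n : ℕ} (u v : Modes n) (ξ : Fin n ⊕ Fin n → ℝ) : ℂ :=
  (starRingEnd ℂ) ⟪expVec u, weyl (phasePoint ξ) (expVec v)⟫_ℂ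

theorem weylKernel_eq {n : ℕ} (u v : Modes n) (ξ : Fin n ⊕ Fin n → ℝ) :
    weylKernel u v ξ = Complex.exp (-((‖phasePoint ξ‖ ^ 2 / 2 : ℝ) : ℂ)
      + (⟪-v, phasePoint ξ⟫_ℂ + ⟪phasePoint ξ, u⟫_ℂ)) * Complex.exp ⟪v, u⟫_ℂ := by
  rw [weylKernel, inner_expVec_weyl_expVec, ← Complex.exp_conj, ← Complex.exp_add]
  congr 1
  simp only [map_add, map_sub, map_neg, Complex.conj_ofReal, inner_conj_symm, inner_neg_left]
  ring

theorem integrable_weylKernel {n : ℕ} (u v : Modes n) : Integrable (weylKernel u v) := by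
  have h := GaussianFourier.integrable_cexp_neg_mul_sum_add (b := 1 / 2) (by norm_num)
    (linCoeff (-v) u)
  refine (h.mul_const (Complex.exp ⟪v, u⟫_ℂ)).congr (Filter.Eventually.of_forall fun ξ => ?_)
  simp only
  rw [weylKernel_eq, inner_add_inner_phasePoint, Complex.ofReal_div, norm_phasePoint_sq]
  congr 3
  push_cast
  ring

theorem integrable_weylKernel_smul {n : ℕ} (u v : Modes n) (y : Fock n) :
    Integrable fun ξ => weylKernel u v ξ • weyl (phasePoint ξ) y := by
  refine ((integrable_weylKernel u v).norm.mul_const ‖y‖).mono' ?_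
    (Filter.Eventually.of_forall fun ξ => ?_)
  · exact (integrable_weylKernel u v).aestronglyMeasurable.smul
      ((continuous_weyl_apply y).comp (continuous_phasePoint n)).aestronglyMeasurable
  · rw [norm_smul, norm_weyl_apply]

/-- Schur orthogonality for the Weyl representation: the Gaussian integral yields `⟪x - v, u - y⟫`,
and adding `⟪v, u⟫ + ⟪x, y⟫` leaves just `⟪v, y⟫ + ⟪x, u⟫`, so the result factorizes. -/
theorem integral_weylKernel_inner {n : ℕ} (u v x y : Modes n) :
    ∫ ξ, weylKernel u v ξ * ⟪expVec x, weyl (phasePoint ξ) (expVec y)⟫_ℂ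
      = (Real.pi : ℂ) ^ n * Complex.exp ⟪v, y⟫_ℂ * Complex.exp ⟪x, u⟫_ℂ := by
  have h : ∀ ξ : Fin n ⊕ Fin n → ℝ,
      weylKernel u v ξ * ⟪expVec x, weyl (phasePoint ξ) (expVec y)⟫_ℂ
      = Complex.exp (-((‖phasePoint ξ‖ ^ 2 : ℝ) : ℂ)
        + (⟪x - v, phasePoint ξ⟫_ℂ + ⟪phasePoint ξ, u - y⟫_ℂ))
          * Complex.exp (⟪v, u⟫_ℂ + ⟪x, y⟫_ℂ) := by
    intro ξ
    rw [weylKernel_eq, inner_expVec_weyl_expVec, ← Complex.exp_add, ← Complex.exp_add,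
      ← Complex.exp_add]
    congr 1
    simp only [inner_sub_left, inner_sub_right, inner_neg_left]
    push_cast
    ring
  simp only [h]
  rw [integral_mul_const, integral_exp_neg_normSq_add, mul_assoc, mul_assoc, ← Complex.exp_add,
    ← Complex.exp_add]
  congr 2
  simp only [inner_sub_left, inner_sub_right]
  ring

theorem integral_weylKernel_smul {n : ℕ} (u v : Modes n) (y : Fock n) :
    ∫ ξ, weylKernel u v ξ • weyl (phasePoint ξ) y
      = ((Real.pi : ℂ) ^ n * ⟪expVec v, y⟫_ℂ) • expVec u := by
  -- Packaging the integral as a bounded operator lets the identity be checked on exponential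
  -- vectors and extended by density.
  let A : Fock n →L[ℂ] Fock n := LinearMap.mkContinuous
    { toFun := fun y => ∫ ξ, weylKernel u v ξ • weyl (phasePoint ξ) y
      map_add' := fun y z => by
        simp only [map_add, smul_add]
        exact integral_add (integrable_weylKernel_smul u v y) (integrable_weylKernel_smul u v z)
      map_smul' := fun c y => by
        simp only [map_smul, smul_comm _ c, RingHom.id_apply]
        exact integral_smul c _ } (∫ ξ, ‖weylKernel u v ξ‖) fun y => by
      refine (norm_integral_le_integral_norm _).trans_eq ?_
      simp only [norm_smul, norm_weyl_apply]
      exact integral_mul_const _ _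
  have hA : A = ((Real.pi : ℂ) ^ n) • InnerProductSpace.rankOne ℂ (expVec u) (expVec v) := by
    refine clm_ext_expVec fun y => ext_inner_expVec fun x => ?_
    change ⟪expVec x, ∫ ξ, weylKernel u v ξ • weyl (phasePoint ξ) (expVec y)⟫_ℂ = _
    rw [← integral_inner (integrable_weylKernel_smul u v _)]
    simp only [inner_smul_right]
    rw [integral_weylKernel_inner]
    simp [inner_expVec, mul_assoc]
  have := DFunLike.congr_fun hA y
  simpa [A, smul_smul] using this

/-! ### Recovering a state from its characteristic function -/

/-- Hilbert basis obtained by applying a unitary. -/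
noncomputable def mapHilbertBasis {ι E : Type*} [NormedAddCommGroup E] [InnerProductSpace ℂ E]
    (b : HilbertBasis ι ℂ E) (U : E ≃ₗᵢ[ℂ] E) : HilbertBasis ι ℂ E :=
  HilbertBasis.ofRepr (U.symm.trans b.repr)

theorem mapHilbertBasis_apply {ι E : Type*} [NormedAddCommGroup E] [InnerProductSpace ℂ E]
    (b : HilbertBasis ι ℂ E) (U : E ≃ₗᵢ[ℂ] E) (i : ι) : mapHilbertBasis b U i = U (b i) := by
  classical
  rw [← HilbertBasis.repr_symm_single, ← HilbertBasis.repr_symm_single]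
  rfl

/-- Cauchy–Schwarz for the form of `T`, in additive form so that summing over a basis produces
traces. -/
theorem norm_inner_map_le_of_isPositive {E : Type*} [NormedAddCommGroup E] [InnerProductSpace ℂ E]
    {T : E →L[ℂ] E} (hT : T.IsPositive) (x y : E) :
    ‖⟪x, T y⟫_ℂ‖ ≤ ((⟪x, T x⟫_ℂ).re + (⟪y, T y⟫_ℂ).re) / 2 := by
  by_cases h0 : ⟪x, T y⟫_ℂ = 0
  · have hx : 0 ≤ (⟪x, T x⟫_ℂ).re := hT.re_inner_nonneg_right x
    have hy : 0 ≤ (⟪y, T y⟫_ℂ).re := hT.re_inner_nonneg_right y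
    rw [h0, norm_zero]
    linarith
  set a := ⟪x, T y⟫_ℂ with ha
  have hn : (‖a‖ : ℂ) ≠ 0 := by simpa using h0
  have hyx : ⟪y, T x⟫_ℂ = (starRingEnd ℂ) a := by
    rw [ha, inner_conj_symm, hT.inner_left_eq_inner_right]
  -- The unit scalar `ā/|a|` rotates both cross terms to `-|a|`.
  have hk : 0 ≤ (⟪x - ((starRingEnd ℂ) a / ‖a‖) • y, T (x - ((starRingEnd ℂ) a / ‖a‖) • y)⟫_ℂ).re :=
    hT.re_inner_nonneg_right _
  have hexp : ⟪x - ((starRingEnd ℂ) a / ‖a‖) • y, T (x - ((starRingEnd ℂ) a / ‖a‖) • y)⟫_ℂ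
      = ⟪x, T x⟫_ℂ + ⟪y, T y⟫_ℂ - 2 * ‖a‖ := by
    simp only [map_sub, map_smul, inner_sub_left, inner_sub_right, inner_smul_left,
      inner_smul_right, hyx, ← ha, map_div₀, Complex.conj_conj, Complex.conj_ofReal]
    have haa : a * (starRingEnd ℂ) a = (‖a‖ : ℂ) ^ 2 := Complex.mul_conj' a
    field_simp
    linear_combination (⟪y, T y⟫_ℂ - 2 * (‖a‖ : ℂ)) * haa
  rw [hexp] at hk
  simp at hk
  linarith

theorem HasTrace.hasSum_re {n : ℕ} {T : Fock n →L[ℂ] Fock n} {c : ℂ} (h : HasTrace T c)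
    {ι : Type} (b : HilbertBasis ι ℂ (Fock n)) : HasSum (fun i => (⟪b i, T (b i)⟫_ℂ).re) c.re :=
  Complex.hasSum_re (h ι b)

/-- Expand the trace `χ` in a basis and integrate termwise against the kernel: Weyl inversion
evaluates each term, and Parseval resums them to a matrix element of `ρ`. -/
theorem IsState.inner_expVec_eq_integral {n : ℕ} {ρ : Fock n →L[ℂ] Fock n} (hρ : IsState ρ)
    {χ : Modes n → ℂ} (hχ : ∀ z, HasTrace (ρ ∘L weyl z) (χ z)) (u v : Modes n) :
    (Real.pi : ℂ) ^ n * ⟪expVec v, ρ (expVec u)⟫_ℂ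
      = ∫ ξ, weylKernel u v ξ * χ (phasePoint ξ) := by
  obtain ⟨s, b, -⟩ := exists_hilbertBasis ℂ (Fock n)
  have := countable_of_hilbertBasis b
  have hsymm := hρ.1.inner_left_eq_inner_right
  have hF : ∀ (i : s) (ξ : Fin n ⊕ Fin n → ℝ),
      weylKernel u v ξ * ⟪b i, ρ (weyl (phasePoint ξ) (b i))⟫_ℂ
        = ⟪ρ (b i), weylKernel u v ξ • weyl (phasePoint ξ) (b i)⟫_ℂ := by
    intro i ξ
    rw [inner_smul_right, hsymm]
  let bound : s → (Fin n ⊕ Fin n → ℝ) → ℝ := fun i ξ => ‖weylKernel u v ξ‖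
    * (((⟪b i, ρ (b i)⟫_ℂ).re
      + (⟪weyl (phasePoint ξ) (b i), ρ (weyl (phasePoint ξ) (b i))⟫_ℂ).re) / 2)
  have hbound : ∀ ξ, HasSum (fun i => bound i ξ) ‖weylKernel u v ξ‖ := by
    intro ξ
    have h1 := hρ.2.hasSum_re b
    -- The displaced vectors again form an orthonormal basis, so both halves of the bound sum to
    -- trace one for every `ξ`.
    have h2 := hρ.2.hasSum_re (mapHilbertBasis b (weylUnitary (phasePoint ξ)))
    simp only [mapHilbertBasis_apply, weylUnitary_apply] at h2
    simpa using ((h1.add h2).div_const 2).mul_left ‖weylKernel u v ξ‖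
  have hsum : HasSum
      (fun i : s => ∫ ξ, weylKernel u v ξ * ⟪b i, ρ (weyl (phasePoint ξ) (b i))⟫_ℂ)
      (∫ ξ, weylKernel u v ξ * χ (phasePoint ξ)) := by
    refine hasSum_integral_of_dominated_convergence bound (fun i => ?_)
      (fun i => Filter.Eventually.of_forall fun ξ => ?_)
      (Filter.Eventually.of_forall fun ξ => (hbound ξ).summable) ?_
      (Filter.Eventually.of_forall fun ξ => (hχ (phasePoint ξ) s b).mul_left _)
    · simp only [hF]
      exact (integrable_weylKernel_smul u v (b i)).aestronglyMeasurable.const_inner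
    · rw [norm_mul]
      exact mul_le_mul_of_nonneg_left (norm_inner_map_le_of_isPositive hρ.1 _ _) (norm_nonneg _)
    · simp only [(hbound _).tsum_eq]
      exact (integrable_weylKernel u v).norm
  have hval : ∀ i : s, ∫ ξ, weylKernel u v ξ * ⟪b i, ρ (weyl (phasePoint ξ) (b i))⟫_ℂ
      = (Real.pi : ℂ) ^ n * (⟪expVec v, b i⟫_ℂ * ⟪b i, ρ (expVec u)⟫_ℂ) := by
    intro i
    simp only [hF]
    rw [integral_inner (integrable_weylKernel_smul u v (b i)), integral_weylKernel_smul,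
      inner_smul_right, hsymm, mul_assoc]
  simp only [hval] at hsum
  exact ((b.hasSum_inner_mul_inner (expVec v) (ρ (expVec u))).mul_left _).unique hsum

theorem IsState.ext_of_hasTrace_weyl {n : ℕ} {ρ σ : Fock n →L[ℂ] Fock n} (hρ : IsState ρ)
    (hσ : IsState σ) {χ : Modes n → ℂ} (hρχ : ∀ z, HasTrace (ρ ∘L weyl z) (χ z))
    (hσχ : ∀ z, HasTrace (σ ∘L weyl z) (χ z)) : ρ = σ := by
  refine clm_ext_expVec fun u => ext_inner_expVec fun v => ?_
  have h := (hρ.inner_expVec_eq_integral hρχ u v).trans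
    (hσ.inner_expVec_eq_integral hσχ u v).symm
  exact mul_left_cancel₀ (pow_ne_zero _ (by exact_mod_cast Real.pi_ne_zero)) h

end QuantumGaussian

theorem mainTheorem4 (n : ℕ) :
    (∀ (μ : EuclideanSpace ℝ (Fin n ⊕ Fin n)) (Sigma : Matrix (Fin n ⊕ Fin n) (Fin n ⊕ Fin n) ℝ),
      Sigma.PosSemidef →
        (∃ ρ : Fock n →L[ℂ] Fock n,
          IsCoherentMixture ρ μ Sigma) ∧
        ∀ ρ : Fock n →L[ℂ] Fock n,
          IsCoherentMixture ρ μ Sigma →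
            IsGaussianState ρ ∧
            ∀ (m : Modes n)
              (S : Modes n →ₗ[ℝ] Modes n),
              IsGaussianWith ρ m S →
                realMatrix S =
                  (1 / 2 : ℝ) • (1 : Matrix (Fin n ⊕ Fin n) (Fin n ⊕ Fin n) ℝ)
                    + (2 : ℝ) • ((sympJ n).transpose * Sigma
                        * sympJ n)) ∧
    (∀ (ρ : Fock n →L[ℂ] Fock n) (m : Modes n)
      (S : Modes n →ₗ[ℝ] Modes n),
      IsGaussianWith ρ m S →
        (IsClassicalGaussian ρ ↔
          (realMatrix S
            - (1 / 2 : ℝ) • (1 : Matrix (Fin n ⊕ Fin n) (Fin n ⊕ Fin n) ℝ)).PosSemidef)) := by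
  have hcov : ∀ {μ : EuclideanSpace ℝ (Fin n ⊕ Fin n)}
      {Sigma : Matrix (Fin n ⊕ Fin n) (Fin n ⊕ Fin n) ℝ}, Sigma.PosSemidef →
      ∀ {ρ : Fock n →L[ℂ] Fock n}, IsCoherentMixture ρ μ Sigma →
      ∀ {m : Modes n} {S : Modes n →ₗ[ℝ] Modes n}, IsGaussianWith ρ m S →
        realMatrix S = mixtureCov Sigma := by
    intro μ Sigma hS ρ hρ m S hG
    rw [hG.realMatrix_eq (hρ.isGaussianWith hS), realMatrix_opOfMatrix]
  refine ⟨fun μ Sigma hS => ⟨exists_isCoherentMixture μ Sigma, fun ρ hρ =>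
    ⟨⟨_, _, hρ.isGaussianWith hS⟩, fun m S hG => hcov hS hρ hG⟩⟩, fun ρ m S hG => ⟨?_, ?_⟩⟩
  · rintro ⟨-, μ, Sigma, hS, hρ⟩
    rw [hcov hS hρ hG, mixtureCov, add_sub_cancel_left]
    exact (posSemidef_transpose_mul_mul hS).smul (by norm_num)
  · intro hB
    set B := realMatrix S - (1 / 2 : ℝ) • (1 : Matrix (Fin n ⊕ Fin n) (Fin n ⊕ Fin n) ℝ) with hBdef
    -- The solution of `2JᵀΣJ = B`, by `JᵀJ = 1`.
    let Sigma := (1 / 2 : ℝ) • (sympJ n * B * (sympJ n).transpose)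
    have hSigma : Sigma.PosSemidef := (posSemidef_mul_mul_transpose hB).smul (by norm_num)
    have hS : mixtureCov Sigma = realMatrix S := by
      have h1 : (sympJ n).transpose * (sympJ n * B * (sympJ n).transpose) * sympJ n = B := by
        calc _ = ((sympJ n).transpose * sympJ n) * B * ((sympJ n).transpose * sympJ n) := by
              simp only [Matrix.mul_assoc]
          _ = B := by rw [sympJ_transpose_mul, Matrix.one_mul, Matrix.mul_one]
      rw [mixtureCov, Matrix.mul_smul, Matrix.smul_mul, h1, smul_smul, hBdef]
      norm_num
    obtain ⟨σ, hσ⟩ := exists_isCoherentMixture (coords m) Sigma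
    have hσG := hσ.isGaussianWith hSigma
    rw [toModes_coords] at hσG
    -- The characteristic function sees the covariance operator only through its quadratic form, so
    -- equality of real matrices suffices.
    have hform : ∀ z : Modes n,
        (⟪z, opOfMatrix (mixtureCov Sigma) z⟫_ℂ).re = (⟪z, S z⟫_ℂ).re := by
      intro z
      rw [← toModes_coords z, re_inner_toModes_map, re_inner_toModes_map, realMatrix_opOfMatrix, hS]
    have hρσ : ρ = σ := by
      refine hG.1.ext_of_hasTrace_weyl hσG.1 hG.2.2 fun z => ?_
      rw [← hform z]
      exact hσG.2.2 z
    exact ⟨⟨m, S, hG⟩, coords m, Sigma, hSigma, hρσ ▸ hσ⟩
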